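/- Let $\mathcal H$ be a complex separable Hilbert space with an orthogonal decomposition $\mathcal H=\mathcal H_+\oplus\mathcal H_-$ into two infinite-dimensional closed subspaces, and let $\mathrm{pr}_\pm$ denote the orthogonal projections onto $\mathcal H_\pm$. For Hilbert spaces $\mathcal H_1,\mathcal H_2$ and $1\le p<\infty$ let $L_p(\mathcal H_1,\mathcal H_2)$ be the Schatten class of bounded operators $A\colon\mathcal H_1\to\mathcal H_2$ with $\mathrm{Tr}\,(A^*A)^{p/2}<\infty$, and let $L_\infty(\mathcal H_1,\mathcal H_2)$ be the space of compact operators. For $1\le p\le\infty$ let $\mathrm{Gr}_{\mathrm{res},p}(\mathcal H)$ be the set of all closed subspaces $V\subseteq\mathcal H$ such that $\mathrm{pr}_+|_V\colon V\to\mathcal H_+$ is a Fredholm operator and $\mathrm{pr}_-|_V\colon V\to\mathcal H_-$ is of class $L_p$. Proposition. Let $1\le p\le\infty$, let $V\subseteq\mathcal H$ be a closed subspace, and let $\mathrm{pr}_V$ be the orthogonal projection of $\mathcal H$ onto $V$. Then $V\in\mathrm{Gr}_{\mathrm{res},p}(\mathcal H)$ if and only if $\mathrm{pr}_V-\mathrm{pr}_+\in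 L_p(\mathcal H)=L_p(\mathcal H,\mathcal H)$. -/

import Mathlib

open scoped ENNReal InnerProductSpace

noncomputable section

namespace RestrictedGrassmannian

variable {E F H : Type*}
  [NormedAddCommGroup E] [InnerProductSpace ℂ E]
  [NormedAddCommGroup F] [InnerProductSpace ℂ F]
  [NormedAddCommGroup H] [InnerProductSpace ℂ H]

/-- The sum `∑ᵢ ⟨eᵢ, T eᵢ⟩ ∈ [0, ∞]` over an orthonormal (Hilbert) basis `(eᵢ)`, which is the trace
of `T` if `T` is a positive operator. -/
def traceOn {ι : Type*} (b : HilbertBasis ι ℂ E) (T : E →L[ℂ] E) : ℝ≥0∞ :=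
  ∑' i, ENNReal.ofReal (⟪b i, T (b i)⟫_ℂ).re

/-- The trace in `[0, ∞]` of a positive operator on a Hilbert space. It is computed in some
Hilbert basis; `trace_eq_traceOn` shows that the choice of the basis does not matter. -/
def trace [CompleteSpace E] (T : E →L[ℂ] E) : ℝ≥0∞ :=
  traceOn (exists_hilbertBasis ℂ E).choose_spec.choose T

/-- Parseval's identity with values in `[0, ∞]`. -/
lemma tsum_ofReal_norm_sq {ι : Type*} (b : HilbertBasis ι ℂ E) (x : E) :
    ∑' i, ENNReal.ofReal (‖⟪b i, x⟫_ℂ‖ ^ 2) = ENNReal.ofReal (‖x‖ ^ 2) := by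
  have h := Complex.hasSum_re (b.hasSum_inner_mul_inner x x)
  have h1 : ∀ i, (⟪x, b i⟫_ℂ * ⟪b i, x⟫_ℂ).re = ‖⟪b i, x⟫_ℂ‖ ^ 2 := fun i => by
    have h0 := inner_mul_symm_re_eq_norm (𝕜 := ℂ) x (b i)
    rw [norm_mul, norm_inner_symm x (b i), ← sq] at h0
    exact h0
  have h2 : (⟪x, x⟫_ℂ).re = ‖x‖ ^ 2 := (norm_sq_eq_re_inner (𝕜 := ℂ) x).symm
  simp only [h1, h2] at h
  rw [← ENNReal.ofReal_tsum_of_nonneg (fun i => sq_nonneg _) h.summable, h.tsum_eq]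

lemma traceOn_eq_traceOn [CompleteSpace E] {ι κ : Type*} (b : HilbertBasis ι ℂ E)
    (c : HilbertBasis κ ℂ E) {T : E →L[ℂ] E} (hT : 0 ≤ T) : traceOn b T = traceOn c T := by
  obtain ⟨S, hS, rfl⟩ : ∃ S : E →L[ℂ] E, IsSelfAdjoint S ∧ S * S = T :=
    ⟨CFC.sqrt T, (CFC.sqrt_nonneg T).isSelfAdjoint, CFC.sqrt_mul_sqrt_self T hT⟩
  have hsym : ∀ x y, ⟪S x, y⟫_ℂ = ⟪x, S y⟫_ℂ := fun x y => hS.isSymmetric x y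
  have key : ∀ x, (⟪x, (S * S) x⟫_ℂ).re = ‖S x‖ ^ 2 := fun x => by
    change (⟪x, S (S x)⟫_ℂ).re = _
    rw [← hsym]
    exact (norm_sq_eq_re_inner (𝕜 := ℂ) (S x)).symm
  simp only [traceOn, key]
  calc ∑' i, ENNReal.ofReal (‖S (b i)‖ ^ 2)
      = ∑' i, ∑' j, ENNReal.ofReal (‖⟪c j, S (b i)⟫_ℂ‖ ^ 2) := by simp only [tsum_ofReal_norm_sq]
    _ = ∑' j, ∑' i, ENNReal.ofReal (‖⟪c j, S (b i)⟫_ℂ‖ ^ 2) := ENNReal.tsum_comm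
    _ = ∑' j, ∑' i, ENNReal.ofReal (‖⟪b i, S (c j)⟫_ℂ‖ ^ 2) := by
        simp only [← hsym, norm_inner_symm]
    _ = ∑' j, ENNReal.ofReal (‖S (c j)‖ ^ 2) := by simp only [tsum_ofReal_norm_sq]

lemma trace_eq_traceOn [CompleteSpace E] {ι : Type*} (b : HilbertBasis ι ℂ E)
    {T : E →L[ℂ] E} (hT : 0 ≤ T) : trace T = traceOn b T :=
  traceOn_eq_traceOn _ b hT

/-- Membership in the Schatten class `L_p(E, F)`: for finite `p`, a bounded operator `A : E → F` is
of class `L_p` if `Tr (A* A)^(p/2) < ∞`, where the power of the positive operator `A* A` is taken in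
the continuous functional calculus; `L_∞(E, F)` consists of the compact operators. -/
def IsSchatten [CompleteSpace E] [CompleteSpace F] (p : ℝ≥0∞) (A : E →L[ℂ] F) : Prop :=
  if p = ∞ then IsCompactOperator A
  else trace ((A.adjoint ∘L A) ^ (p.toReal / 2)) < ∞

instance [CompleteSpace H] (V : ClosedSubmodule ℂ H) : CompleteSpace V.toSubmodule :=
  V.isClosed.completeSpace_coe

/-- The restriction `pr_W|_V : V → W` to `V` of the orthogonal projection of `H` onto `W`. -/
def projOn [CompleteSpace H] (V W : ClosedSubmodule ℂ H) : V.toSubmodule →L[ℂ] W.toSubmodule :=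
  W.toSubmodule.orthogonalProjectionOnto ∘L V.toSubmodule.subtypeL

/-- The restricted `p`-Schatten class Grassmannian of `H = H₊ ⊕ H₋`, with `H₋` the orthogonal
complement of `H₊`: the closed subspaces `V` such that `pr₊|_V : V → H₊` is a Fredholm operator and
`pr₋|_V : V → H₋` is of class `L_p`. -/
def grRes [CompleteSpace H] (p : ℝ≥0∞) (Hplus : ClosedSubmodule ℂ H) :
    Set (ClosedSubmodule ℂ H) :=
  {V | (projOn V Hplus).IsFredholm ∧ IsSchatten p (projOn V Hplusᗮ)}

end RestrictedGrassmannian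

end

/-! Write `P`, `Q` for the projections onto `V` and `H₊`, and `D = P - Q`. Then `D²` commutes with
`P` and `Q`, and its compression to `V` is `A* A` for `A = pr₋|_V`. For finite `p` put `R =
|D|^(p/2)`: `D` is of class `L_p` iff `R` is Hilbert-Schmidt, and `A` is iff `R P` is.

If `D` is of class `L_p`, so is `A`. Moreover `D` is compact, and `C = pr₊|_V` is Fredholm because
`C* C` and `C C*` are the identity minus compressions of `D²` (`isFredholm_projOn`).

Conversely, split `R = R Q + R (1 - Q)`. The odd power `S = sgn(D)|D|^(p/2)` satisfies `S P = (1 -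
Q) S`, so `R (1 - Q)` and `R P` have equal Hilbert-Schmidt norms
(`hsNormSq_mul_starProjection_orthogonal`). Fredholmness gives `Q = Q P G + K` with `K` of finite
rank, so `R Q = Q (R P) G + R K` is Hilbert-Schmidt as well. Thus only ideal properties of
Hilbert-Schmidt operators are needed. For `p = ∞` the compactness of `D` follows from that of `D²`.
-/

namespace RestrictedGrassmannian

/-! ### Hilbert-Schmidt operators. -/

section HilbertSchmidt

variable {E F G : Type*}
  [NormedAddCommGroup E] [InnerProductSpace ℂ E] [CompleteSpace E]
  [NormedAddCommGroup F] [InnerProductSpace ℂ F] [CompleteSpace F]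
  [NormedAddCommGroup G] [InnerProductSpace ℂ G] [CompleteSpace G]

/-- The square of the Hilbert-Schmidt norm of an operator, with values in `[0, ∞]`. -/
noncomputable def hsNormSq (X : E →L[ℂ] F) : ℝ≥0∞ := trace (X.adjoint ∘L X)

lemma hsNormSq_eq_tsum {ι : Type*} (b : HilbertBasis ι ℂ E) (X : E →L[ℂ] F) :
    hsNormSq X = ∑' i, ENNReal.ofReal (‖X (b i)‖ ^ 2) := by
  have h0 : 0 ≤ X.adjoint ∘L X := by
    rw [ContinuousLinearMap.nonneg_iff_isPositive]
    exact ContinuousLinearMap.isPositive_adjoint_comp_self X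
  rw [hsNormSq, trace_eq_traceOn b h0, traceOn]
  refine tsum_congr fun i => ?_
  rw [ContinuousLinearMap.comp_apply, ContinuousLinearMap.adjoint_inner_right]
  exact congrArg _ (norm_sq_eq_re_inner (𝕜 := ℂ) (X (b i))).symm

lemma hsNormSq_congr {X : E →L[ℂ] F} {Y : E →L[ℂ] G} (h : ∀ x, ‖X x‖ = ‖Y x‖) :
    hsNormSq X = hsNormSq Y := by
  obtain ⟨w, b, -⟩ := exists_hilbertBasis ℂ E
  simp only [hsNormSq_eq_tsum b, h]

lemma hsNormSq_adjoint (X : E →L[ℂ] F) : hsNormSq X.adjoint = hsNormSq X := by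
  obtain ⟨w, b, -⟩ := exists_hilbertBasis ℂ E
  obtain ⟨v, c, -⟩ := exists_hilbertBasis ℂ F
  rw [hsNormSq_eq_tsum b, hsNormSq_eq_tsum c]
  calc ∑' j, ENNReal.ofReal (‖X.adjoint (c j)‖ ^ 2)
      = ∑' j, ∑' i, ENNReal.ofReal (‖⟪b i, X.adjoint (c j)⟫_ℂ‖ ^ 2) := by
        simp only [tsum_ofReal_norm_sq]
    _ = ∑' i, ∑' j, ENNReal.ofReal (‖⟪b i, X.adjoint (c j)⟫_ℂ‖ ^ 2) := ENNReal.tsum_comm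
    _ = ∑' i, ∑' j, ENNReal.ofReal (‖⟪c j, X (b i)⟫_ℂ‖ ^ 2) := by
        simp only [ContinuousLinearMap.adjoint_inner_right, norm_inner_symm]
    _ = ∑' i, ENNReal.ofReal (‖X (b i)‖ ^ 2) := by simp only [tsum_ofReal_norm_sq]

lemma hsNormSq_comp_lt_top_left (Y : F →L[ℂ] G) {X : E →L[ℂ] F} (hX : hsNormSq X < ∞) :
    hsNormSq (Y ∘L X) < ∞ := by
  obtain ⟨w, b, -⟩ := exists_hilbertBasis ℂ E
  rw [hsNormSq_eq_tsum b] at hX ⊢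
  refine lt_of_le_of_lt ?_ (ENNReal.mul_lt_top (ENNReal.ofReal_lt_top (r := ‖Y‖ ^ 2)) hX)
  rw [← ENNReal.tsum_mul_left]
  refine ENNReal.tsum_le_tsum fun i => ?_
  rw [← ENNReal.ofReal_mul (sq_nonneg _), ← mul_pow]
  exact ENNReal.ofReal_le_ofReal (by gcongr; exact Y.le_opNorm _)

lemma hsNormSq_comp_lt_top_right {Y : F →L[ℂ] G} (X : E →L[ℂ] F) (hY : hsNormSq Y < ∞) :
    hsNormSq (Y ∘L X) < ∞ := by
  rw [← hsNormSq_adjoint, ContinuousLinearMap.adjoint_comp]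
  exact hsNormSq_comp_lt_top_left _ (by rwa [hsNormSq_adjoint])

lemma hsNormSq_add_lt_top {X Y : E →L[ℂ] F} (hX : hsNormSq X < ∞) (hY : hsNormSq Y < ∞) :
    hsNormSq (X + Y) < ∞ := by
  obtain ⟨w, b, -⟩ := exists_hilbertBasis ℂ E
  rw [hsNormSq_eq_tsum b] at hX hY ⊢
  refine lt_of_le_of_lt ?_ (ENNReal.mul_lt_top (ENNReal.ofReal_lt_top (r := 2))
    (ENNReal.add_lt_top.2 ⟨hX, hY⟩))
  rw [← ENNReal.tsum_add, ← ENNReal.tsum_mul_left]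
  refine ENNReal.tsum_le_tsum fun i => ?_
  rw [← ENNReal.ofReal_add (sq_nonneg _) (sq_nonneg _), ← ENNReal.ofReal_mul zero_le_two]
  refine ENNReal.ofReal_le_ofReal ?_
  calc ‖(X + Y) (b i)‖ ^ 2 ≤ (‖X (b i)‖ + ‖Y (b i)‖) ^ 2 := by
        gcongr; exact norm_add_le _ _
    _ ≤ _ := add_sq_le

lemma hsNormSq_lt_top_of_finiteDimensional [FiniteDimensional ℂ E] (X : E →L[ℂ] F) :
    hsNormSq X < ∞ := by
  rw [hsNormSq_eq_tsum (stdOrthonormalBasis ℂ E).toHilbertBasis, tsum_fintype]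
  exact ENNReal.sum_lt_top.2 fun _ _ => ENNReal.ofReal_lt_top

omit [CompleteSpace E] [CompleteSpace F] in
lemma exists_eq_subtypeL_comp {X : E →L[ℂ] F} (hX : X.toLinearMap.HasFiniteRange) :
    ∃ (W : Submodule ℂ F) (_ : FiniteDimensional ℂ W) (Y : E →L[ℂ] W), X = W.subtypeL ∘L Y :=
  ⟨LinearMap.range X.toLinearMap, Submodule.fg_iff_finiteDimensional _ |>.1 hX.fg_range,
    X.codRestrict _ fun x => LinearMap.mem_range_self _ x, rfl⟩

lemma hsNormSq_lt_top_of_hasFiniteRange {X : E →L[ℂ] F} (hX : X.toLinearMap.HasFiniteRange) :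
    hsNormSq X < ∞ := by
  obtain ⟨W, hW, Y, rfl⟩ := exists_eq_subtypeL_comp hX
  have := FiniteDimensional.complete ℂ W
  refine hsNormSq_comp_lt_top_left W.subtypeL ?_
  rw [← hsNormSq_adjoint]
  exact hsNormSq_lt_top_of_finiteDimensional _

omit [CompleteSpace E] [CompleteSpace F] in
lemma isCompactOperator_of_hasFiniteRange {X : E →L[ℂ] F} (hX : X.toLinearMap.HasFiniteRange) :
    IsCompactOperator X := by
  obtain ⟨W, hW, Y, rfl⟩ := exists_eq_subtypeL_comp hX
  have : ProperSpace W := FiniteDimensional.proper ℂ W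
  exact (isCompactOperator_of_locallyCompactSpace_dom Y).clm_comp W.subtypeL

/-- Truncating `X` along a Hilbert basis of the target gives finite-rank operators; the squared norm
of the error is at most a tail of the convergent series `∑ ‖X* cⱼ‖²`. -/
lemma isCompactOperator_of_hsNormSq_lt_top {X : E →L[ℂ] F} (hX : hsNormSq X < ∞) :
    IsCompactOperator X := by
  classical
  obtain ⟨v, c, -⟩ := exists_hilbertBasis ℂ F
  rw [← hsNormSq_adjoint, hsNormSq_eq_tsum c] at hX
  let T : Finset v → E →L[ℂ] F := fun s =>
    ∑ j ∈ s, (innerSL ℂ (X.adjoint (c j))).smulRight (c j)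
  have hT : ∀ s x, T s x = ∑ j ∈ s, ⟪c j, X x⟫_ℂ • c j := fun s x => by
    simp [T, ContinuousLinearMap.adjoint_inner_left]
  have hcoef : ∀ s x j, ⟪c j, (X - T s) x⟫_ℂ = if j ∈ s then 0 else ⟪c j, X x⟫_ℂ := fun s x j => by
    rw [sub_apply, hT, inner_sub_right]
    split_ifs with h
    · rw [c.orthonormal.inner_right_sum _ h, sub_self]
    · rw [inner_sum, Finset.sum_eq_zero, sub_zero]
      intro i hi
      rw [inner_smul_right, c.orthonormal.2 (fun e => h (by rwa [e])), mul_zero]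
  have hbound : ∀ s x, ENNReal.ofReal (‖(X - T s) x‖ ^ 2) ≤
      (∑' j : {j // j ∉ s}, ENNReal.ofReal (‖X.adjoint (c j)‖ ^ 2)) * ENNReal.ofReal (‖x‖ ^ 2) :=
      fun s x => by
    rw [← tsum_ofReal_norm_sq c, ← ENNReal.tsum_mul_right]
    refine le_of_le_of_eq ?_ (tsum_subtype {j | j ∉ s}
      fun j => ENNReal.ofReal (‖X.adjoint (c j)‖ ^ 2) * ENNReal.ofReal (‖x‖ ^ 2)).symm
    refine ENNReal.tsum_le_tsum fun j => ?_
    rw [hcoef]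
    by_cases h : j ∈ s
    · simp [h]
    · rw [if_neg h, Set.indicator_of_mem (by exact h), ← ENNReal.ofReal_mul (sq_nonneg _),
        ← mul_pow, ← ContinuousLinearMap.adjoint_inner_left]
      exact ENNReal.ofReal_le_ofReal (by gcongr; exact norm_inner_le_norm _ _)
  refine isCompactOperator_of_tendsto (l := Filter.atTop) (F := T) ?_ (.of_forall fun s => ?_)
  · rw [tendsto_iff_norm_sub_tendsto_zero]
    refine Metric.tendsto_atTop.2 fun ε hε => ?_
    have h1 := (ENNReal.tendsto_tsum_compl_atTop_zero hX.ne).eventually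
      (gt_mem_nhds (show (0 : ℝ≥0∞) < ENNReal.ofReal ((ε / 2) ^ 2) by positivity))
    obtain ⟨s₀, hs₀⟩ := Filter.eventually_atTop.1 h1
    refine ⟨s₀, fun s hs => ?_⟩
    rw [dist_zero_right, norm_norm, norm_sub_rev]
    refine lt_of_le_of_lt (ContinuousLinearMap.opNorm_le_bound _ (half_pos hε).le fun x => ?_)
      (half_lt_self hε)
    have h2 : ENNReal.ofReal (‖(X - T s) x‖ ^ 2) ≤
        ENNReal.ofReal ((ε / 2) ^ 2) * ENNReal.ofReal (‖x‖ ^ 2) :=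
      (hbound s x).trans (by gcongr; exact (hs₀ s hs).le)
    rw [← ENNReal.ofReal_mul (sq_nonneg _), ← mul_pow,
      ENNReal.ofReal_le_ofReal_iff (sq_nonneg _)] at h2
    exact (pow_le_pow_iff_left₀ (norm_nonneg _) (by positivity) two_ne_zero).1 h2
  · refine isCompactOperator_of_hasFiniteRange ?_
    rw [LinearMap.HasFiniteRange]
    refine Submodule.FG.of_le (T := Submodule.span ℂ (c '' s)) ?_ ?_
    · exact Submodule.fg_span (s.finite_toSet.image _)
    · rintro _ ⟨x, rfl⟩
      change T s x ∈ _
      rw [hT]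
      exact Submodule.sum_mem _ fun j hj =>
        Submodule.smul_mem _ _ (Submodule.subset_span ⟨j, hj, rfl⟩)

end HilbertSchmidt

/-! ### Compact operators and Fredholmness. -/

section Compact

variable {E F : Type*}
  [NormedAddCommGroup E] [InnerProductSpace ℂ E] [CompleteSpace E]
  [NormedAddCommGroup F] [InnerProductSpace ℂ F] [CompleteSpace F]

/-- Since `‖X z‖² ≤ ‖z‖ ‖X* X z‖`, a finite net for the image of the unit ball under `X* X` yields
one for its image under `X`. -/
lemma isCompactOperator_of_adjoint_comp_self {X : E →L[ℂ] F}
    (hX : IsCompactOperator (X.adjoint ∘L X)) : IsCompactOperator X := by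
  change IsCompactOperator X.toLinearMap
  rw [isCompactOperator_iff_isCompact_closure_image_closedBall X.toLinearMap zero_lt_one]
  have hY : TotallyBounded ((X.adjoint ∘L X) '' Metric.closedBall 0 1) :=
    (IsCompactOperator.isCompact_closure_image_closedBall
      (f := (X.adjoint ∘L X).toLinearMap) hX 1).totallyBounded.subset subset_closure
  suffices h : TotallyBounded (X '' Metric.closedBall 0 1) from
    h.closure.isCompact_of_isClosed isClosed_closure
  refine Metric.totallyBounded_iff.2 fun ε hε => ?_
  -- Points of the unit ball are at distance at most `2`, so the radius `ε² / 2` gives `‖X (x - y)‖²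
  -- < ε²`.
  obtain ⟨t, ht, htf, hcov⟩ :=
    Metric.finite_approx_of_totallyBounded hY (ε ^ 2 / 2) (by positivity)
  obtain ⟨u, hu, huf, rfl⟩ := Set.exists_subset_image_finite_and.1 ⟨t, ht, htf, rfl⟩
  refine ⟨X '' u, huf.image _, ?_⟩
  rintro _ ⟨x, hx, rfl⟩
  obtain ⟨y', hy', hxy⟩ := Set.mem_iUnion₂.1 (hcov ⟨x, hx, rfl⟩)
  obtain ⟨y, hy, rfl⟩ := hy'
  refine Set.mem_iUnion₂.2 ⟨X y, ⟨y, hy, rfl⟩, ?_⟩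
  rw [Metric.mem_ball, dist_eq_norm, ← map_sub] at hxy ⊢
  have h1 : ‖x - y‖ ≤ 2 := by
    have h2 := hu hy
    rw [mem_closedBall_zero_iff] at hx h2
    linarith [norm_sub_le x y]
  have h3 : ‖X (x - y)‖ ^ 2 ≤ ‖x - y‖ * ‖(X.adjoint ∘L X) (x - y)‖ := by
    have h4 : ‖X (x - y)‖ ^ 2 = (⟪x - y, (X.adjoint ∘L X) (x - y)⟫_ℂ).re := by
      rw [ContinuousLinearMap.comp_apply, ContinuousLinearMap.adjoint_inner_right]
      exact norm_sq_eq_re_inner (𝕜 := ℂ) _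
    rw [h4]
    exact (Complex.re_le_norm _).trans (norm_inner_le_norm _ _)
  refine lt_of_pow_lt_pow_left₀ 2 hε.le ?_
  nlinarith [norm_nonneg (x - y), norm_nonneg ((X.adjoint ∘L X) (x - y))]

lemma isCompactOperator_of_pow_two_pow {X : E →L[ℂ] E} (hX : IsSelfAdjoint X) (n : ℕ)
    (h : IsCompactOperator (X ^ 2 ^ n : E →L[ℂ] E)) : IsCompactOperator X := by
  induction n with
  | zero => simpa using h
  | succ n ih =>
    refine ih (isCompactOperator_of_adjoint_comp_self (X := X ^ 2 ^ n) ?_)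
    rw [(hX.pow (2 ^ n)).adjoint_eq]
    change IsCompactOperator (X ^ 2 ^ n * X ^ 2 ^ n : E →L[ℂ] E)
    rwa [← pow_add, ← two_mul, ← pow_succ']

open scoped LinearMap.FiniteRangeSetoid in
/-- A compact self-adjoint perturbation of the identity is invertible modulo operators of
finite rank. -/
lemma exists_isQuasiInverse_one_sub {K : E →L[ℂ] E} (hK : IsCompactOperator K)
    (hsa : IsSelfAdjoint K) :
    ∃ G : E →L[ℂ] E, G.toLinearMap.IsQuasiInverse (1 - K).toLinearMap := by
  let N := Module.End.eigenspace K.toLinearMap (1 : ℂ)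
  have hN : FiniteDimensional ℂ N :=
    ContinuousLinearMap.finite_dimensional_eigenspace hK 1 one_ne_zero
  have hfin : N.starProjection.toLinearMap.HasFiniteRange := by
    rw [LinearMap.HasFiniteRange, Submodule.range_starProjection]
    exact Submodule.fg_iff_finiteDimensional _ |>.2 hN
  have hmem : ∀ {x}, x ∈ N ↔ K x = x := fun {x} => by
    rw [Module.End.mem_eigenspace_iff, one_smul]; rfl
  -- Subtracting the projection onto the finite-dimensional fixed space of `K` removes the
  -- eigenvalue `1`; the Fredholm alternative then gives invertibility.
  have hunit : IsUnit (1 - (K - N.starProjection)) := by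
    have hcpt : IsCompactOperator (K - N.starProjection : E →L[ℂ] E) :=
      hK.sub (isCompactOperator_of_hasFiniteRange hfin)
    rcases hcpt.hasEigenvalue_or_mem_resolventSet (one_ne_zero (α := ℂ)) with h | h
    · exfalso
      obtain ⟨x, hx⟩ := h.exists_hasEigenvector
      have hx1 : K x - N.starProjection x = x := by simpa using hx.apply_eq_smul
      have hx2 : N.starProjection x = 0 := by
        have h1 : ∀ y ∈ N, ⟪y, x⟫_ℂ = 0 := fun y hy => by
          have hsym : ⟪y, K x⟫_ℂ = ⟪y, x⟫_ℂ := by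
            exact (hsa.isSymmetric y x).symm.trans (congrArg (⟪·, x⟫_ℂ) (hmem.1 hy))
          have hproj : ⟪y, N.starProjection x⟫_ℂ = ⟪y, x⟫_ℂ := by
            rw [← N.inner_starProjection_left_eq_right, N.starProjection_eq_self_iff.2 hy]
          rw [← hx1, inner_sub_right, hsym, hproj, sub_self]
        exact (N.starProjection_apply_eq_zero_iff).2 h1
      refine hx.2 ?_
      rw [hx2, sub_zero] at hx1
      rw [← hx2]
      exact (N.starProjection_eq_self_iff.2 (hmem.2 hx1)).symm
    · simpa [spectrum.mem_resolventSet_iff] using h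
  obtain ⟨u, hu⟩ := hunit
  have heq : (1 - K).toLinearMap ≈ (u : E →L[ℂ] E).toLinearMap := by
    rw [LinearMap.FiniteRangeSetoid.equiv_iff_hasFiniteRange, hu]
    have : (1 - K).toLinearMap - (1 - (K - N.starProjection)).toLinearMap =
        -N.starProjection.toLinearMap := by
      ext x
      simp
    rw [this]
    exact hfin.neg
  refine ⟨(↑u⁻¹ : E →L[ℂ] E), LinearMap.IsQuasiInverse.congr (v := (u : E →L[ℂ] E).toLinearMap)
    ⟨?_, ?_⟩ (Setoid.refl _) heq⟩
  · have : (↑u⁻¹ : E →L[ℂ] E).toLinearMap ∘ₗ (u : E →L[ℂ] E).toLinearMap = LinearMap.id :=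
      congrArg ContinuousLinearMap.toLinearMap u.inv_mul
    rw [LinearMap.IsLeftQuasiInverse, this]
  · have : (u : E →L[ℂ] E).toLinearMap ∘ₗ (↑u⁻¹ : E →L[ℂ] E).toLinearMap = LinearMap.id :=
      congrArg ContinuousLinearMap.toLinearMap u.mul_inv
    rw [LinearMap.IsRightQuasiInverse, this]

-- Quasi-inverses of `C* C` and `C C*` give a left and a right quasi-inverse of `C`, which agree
-- modulo finite rank by the usual associativity argument.
open scoped LinearMap.FiniteRangeSetoid in
lemma isFredholm_of_isCompactOperator_one_sub {C : E →L[ℂ] F} {K : E →L[ℂ] E} {L : F →L[ℂ] F}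
    (hK : IsCompactOperator K) (hL : IsCompactOperator L)
    (hCK : C.adjoint ∘L C = 1 - K) (hCL : C ∘L C.adjoint = 1 - L) : C.IsFredholm := by
  have hKs : IsSelfAdjoint K := by
    rw [← sub_sub_cancel 1 K, ← hCK]
    exact (IsSelfAdjoint.one _).sub (ContinuousLinearMap.isPositive_adjoint_comp_self C).isSelfAdjoint
  have hLs : IsSelfAdjoint L := by
    rw [← sub_sub_cancel 1 L, ← hCL]
    exact (IsSelfAdjoint.one _).sub (ContinuousLinearMap.isPositive_self_comp_adjoint C).isSelfAdjoint
  obtain ⟨G, hG⟩ := exists_isQuasiInverse_one_sub hK hKs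
  obtain ⟨G', hG'⟩ := exists_isQuasiInverse_one_sub hL hLs
  rw [← hCK] at hG
  rw [← hCL] at hG'
  have hl : (G ∘L C.adjoint).toLinearMap ∘ₗ C.toLinearMap ≈ LinearMap.id := hG.1
  have hr : C.toLinearMap ∘ₗ (C.adjoint ∘L G').toLinearMap ≈ LinearMap.id := hG'.2
  have heq : (G ∘L C.adjoint).toLinearMap ≈ (C.adjoint ∘L G').toLinearMap := by
    calc (G ∘L C.adjoint).toLinearMap
        = (G ∘L C.adjoint).toLinearMap ∘ₗ LinearMap.id := by simp
      _ ≈ (G ∘L C.adjoint).toLinearMap ∘ₗ (C.toLinearMap ∘ₗ (C.adjoint ∘L G').toLinearMap) := by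
          grw [hr]
      _ = ((G ∘L C.adjoint).toLinearMap ∘ₗ C.toLinearMap) ∘ₗ (C.adjoint ∘L G').toLinearMap := rfl
      _ ≈ LinearMap.id ∘ₗ (C.adjoint ∘L G').toLinearMap := by grw [hl]
      _ = (C.adjoint ∘L G').toLinearMap := by simp
  refine ContinuousLinearMap.IsFredholm.of_isQuasiInverse (v := C.adjoint ∘L G') ⟨?_, hr⟩
  exact Setoid.trans (LinearMap.FiniteRangeSetoid.equiv_comp_right (Setoid.symm heq)) hl

end Compact

/-! ### Intertwining and the continuous functional calculus. -/

section Intertwining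

variable {E F : Type*}
  [NormedAddCommGroup E] [InnerProductSpace ℂ E] [CompleteSpace E]
  [NormedAddCommGroup F] [InnerProductSpace ℂ F] [CompleteSpace F]

open Polynomial in
lemma norm_cfc_sub_aeval_le {c : E →L[ℂ] E} (hc : IsSelfAdjoint c) {f : ℝ → ℝ} (hf : Continuous f)
    {q : ℝ[X]} {M δ : ℝ} (hM : ‖c‖ ≤ M) (hδ : 0 ≤ δ)
    (hq : ∀ x ∈ Set.Icc (-M) M, |q.eval x - f x| ≤ δ) : ‖cfc f c - aeval c q‖ ≤ δ := by
  rw [← cfc_polynomial q c hc, ← cfc_sub f q.eval c hf.continuousOn q.continuous.continuousOn]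
  refine norm_cfc_le hδ fun x hx => ?_
  have h1 : ‖x‖ ≤ M := calc
    ‖x‖ ≤ ‖c‖ * ‖(1 : E →L[ℂ] E)‖ := spectrum.norm_le_norm_mul_of_mem hx
    -- The identity has norm `0` when `E` is trivial, hence an inequality.
    _ ≤ ‖c‖ * 1 := by gcongr; exact ContinuousLinearMap.norm_id_le
    _ ≤ M := by rwa [mul_one]
  rw [Real.norm_eq_abs, abs_sub_comm]
  exact hq x (abs_le.1 h1)

open Polynomial in
/-- An operator that intertwines two self-adjoint operators intertwines the values of a continuous
function on them. -/
lemma comp_cfc_eq_cfc_comp {a : E →L[ℂ] E} {b : F →L[ℂ] F} {X : E →L[ℂ] F}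
    (ha : IsSelfAdjoint a) (hb : IsSelfAdjoint b) (h : X ∘L a = b ∘L X) {f : ℝ → ℝ}
    (hf : Continuous f) : X ∘L cfc f a = cfc f b ∘L X := by
  have hpoly : ∀ q : ℝ[X], X ∘L aeval a q = aeval b q ∘L X := fun q => by
    induction q using Polynomial.induction_on' with
    | add p q hp hq => simp only [map_add, ContinuousLinearMap.comp_add,
        ContinuousLinearMap.add_comp, hp, hq]
    | monomial n r =>
      have hn : X ∘L (a ^ n) = (b ^ n) ∘L X := by
        induction n with
        | zero => rfl
        | succ n ih =>
          rw [pow_succ, pow_succ, ContinuousLinearMap.mul_def, ContinuousLinearMap.mul_def,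
            ← ContinuousLinearMap.comp_assoc, ih, ContinuousLinearMap.comp_assoc, h,
            ContinuousLinearMap.comp_assoc]
      rw [aeval_monomial, aeval_monomial, ← Algebra.smul_def, ← Algebra.smul_def]
      rw [ContinuousLinearMap.comp_smul, ContinuousLinearMap.smul_comp, hn]
  -- One interval containing both spectra, so that a single polynomial approximates `f` on both.
  set M := max ‖a‖ ‖b‖
  rw [← sub_eq_zero, ← norm_le_zero_iff]
  refine le_of_forall_pos_le_add fun ε hε => ?_
  rw [zero_add]
  set δ := ε / (2 * (‖X‖ + 1)) with hδ
  have hδ0 : 0 < δ := by positivity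
  obtain ⟨q, hq⟩ := exists_polynomial_near_of_continuousOn (-M) M f hf.continuousOn δ hδ0
  have h1 : X ∘L cfc f a - cfc f b ∘L X =
      X ∘L (cfc f a - aeval a q) - (cfc f b - aeval b q) ∘L X := by
    rw [ContinuousLinearMap.comp_sub, ContinuousLinearMap.sub_comp, hpoly]
    abel
  have ha' := norm_cfc_sub_aeval_le ha hf (le_max_left ‖a‖ ‖b‖) hδ0.le fun x hx => (hq x hx).le
  have hb' := norm_cfc_sub_aeval_le hb hf (le_max_right ‖a‖ ‖b‖) hδ0.le fun x hx => (hq x hx).le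
  have h2 : 2 * (‖X‖ + 1) * δ = ε := by
    rw [hδ]; field_simp
  calc ‖X ∘L cfc f a - cfc f b ∘L X‖
      ≤ ‖X ∘L (cfc f a - aeval a q)‖ + ‖(cfc f b - aeval b q) ∘L X‖ := by
        rw [h1]; exact norm_sub_le _ _
    _ ≤ ‖X‖ * δ + δ * ‖X‖ := by
        gcongr
        · exact (ContinuousLinearMap.opNorm_comp_le _ _).trans (by gcongr)
        · exact (ContinuousLinearMap.opNorm_comp_le _ _).trans (by gcongr)
    _ ≤ ε := by nlinarith

end Intertwining

end RestrictedGrassmannian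

namespace RestrictedGrassmannian

/-! ### Powers `|T|^θ` and the Schatten condition. -/

section AbsPow

variable {E F : Type*}
  [NormedAddCommGroup E] [InnerProductSpace ℂ E] [CompleteSpace E]
  [NormedAddCommGroup F] [InnerProductSpace ℂ F] [CompleteSpace F]

/-- The operator `|T| ^ θ`, for a self-adjoint operator `T`. -/
noncomputable def absPow (θ : ℝ) (T : E →L[ℂ] E) : E →L[ℂ] E := cfc (fun x : ℝ => |x| ^ θ) T

lemma continuous_abs_rpow {θ : ℝ} (hθ : 0 < θ) : Continuous fun x : ℝ => |x| ^ θ :=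
  continuous_abs.rpow_const fun _ => .inr hθ.le

lemma isSelfAdjoint_absPow (θ : ℝ) (T : E →L[ℂ] E) : IsSelfAdjoint (absPow θ T) :=
  cfc_predicate _ _

lemma absPow_mul_self {θ : ℝ} (hθ : 0 < θ) {T : E →L[ℂ] E} (hT : 0 ≤ T) :
    absPow θ T * absPow θ T = T ^ (2 * θ) := by
  rw [absPow, ← cfc_mul _ _ T (continuous_abs_rpow hθ).continuousOn
    (continuous_abs_rpow hθ).continuousOn, CFC.rpow_eq_cfc_real]
  refine cfc_congr fun x hx => ?_
  have hx0 : 0 ≤ x := spectrum_nonneg_of_nonneg hT hx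
  change |x| ^ θ * |x| ^ θ = x ^ (2 * θ)
  rw [abs_of_nonneg hx0, two_mul, Real.rpow_add_of_nonneg hx0 hθ.le hθ.le]

lemma adjoint_comp_self_nonneg (A : E →L[ℂ] F) : 0 ≤ A.adjoint ∘L A := by
  rw [ContinuousLinearMap.nonneg_iff_isPositive]
  exact ContinuousLinearMap.isPositive_adjoint_comp_self A

/-- The exponent `p / 4` is half of `p / 2`: the trace of `(A* A)^(p/2)` is the squared
Hilbert-Schmidt norm of its square root. -/
lemma isSchatten_iff_hsNormSq_lt_top {p : ℝ≥0∞} (hp0 : p ≠ 0) (hp : p ≠ ∞) (A : E →L[ℂ] F) :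
    IsSchatten p A ↔ hsNormSq (absPow (p.toReal / 4) (A.adjoint ∘L A)) < ∞ := by
  have hpos : 0 < p.toReal / 4 := div_pos (ENNReal.toReal_pos hp0 hp) four_pos
  rw [IsSchatten, if_neg hp, hsNormSq, (isSelfAdjoint_absPow _ _).adjoint_eq,
    ← ContinuousLinearMap.mul_def, absPow_mul_self hpos (adjoint_comp_self_nonneg A),
    show 2 * (p.toReal / 4) = p.toReal / 2 by ring]

lemma norm_apply_eq_of_mul_self_eq {S T : E →L[ℂ] E} (hS : IsSelfAdjoint S) (hT : IsSelfAdjoint T)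
    (h : S * S = T * T) (x : E) : ‖S x‖ = ‖T x‖ := by
  rw [← sq_eq_sq₀ (norm_nonneg _) (norm_nonneg _), norm_sq_eq_re_inner (𝕜 := ℂ),
    norm_sq_eq_re_inner (𝕜 := ℂ), ← ContinuousLinearMap.adjoint_inner_right,
    ← ContinuousLinearMap.adjoint_inner_right, hS.adjoint_eq, hT.adjoint_eq]
  exact congrArg (fun Y : E →L[ℂ] E => RCLike.re ⟪x, Y x⟫_ℂ) h

/-- The odd power `sgn(D) |D| ^ (2θ)` of a self-adjoint operator `D` anticommutes with every
operator that anticommutes with `D`. -/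
lemma exists_mul_self_eq_absPow_mul_self {θ : ℝ} (hθ : 0 < θ) {D : E →L[ℂ] E}
    (hD : IsSelfAdjoint D) :
    ∃ S : E →L[ℂ] E, IsSelfAdjoint S ∧ S * S = absPow θ (D * D) * absPow θ (D * D) ∧
      S * D = D * S ∧ ∀ C : E →L[ℂ] E, C * D = -D * C → C * S = -S * C := by
  -- This is `sgn(x) |x|^(2θ)`, in a form that is visibly continuous and odd.
  let s : ℝ → ℝ := fun x => max x 0 ^ (2 * θ) - max (-x) 0 ^ (2 * θ)
  have h2θ : 0 < 2 * θ := by positivity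
  have hs : Continuous s :=
    ((continuous_id.max continuous_const).rpow_const fun _ => .inr h2θ.le).sub
      ((continuous_neg.max continuous_const).rpow_const fun _ => .inr h2θ.le)
  have hodd : ∀ x, s (-x) = -s x := fun x => by simp [s]
  have hsq : ∀ x, s x * s x = |x ^ 2| ^ θ * |x ^ 2| ^ θ := by
    have hnn : ∀ x, 0 ≤ x → s x * s x = |x ^ 2| ^ θ * |x ^ 2| ^ θ := fun x hx => by
      have : s x = |x ^ 2| ^ θ := by
        simp only [s, max_eq_left hx, max_eq_right (neg_nonpos.2 hx), Real.zero_rpow h2θ.ne',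
          sub_zero, abs_of_nonneg (sq_nonneg x)]
        rw [Real.rpow_mul hx, Real.rpow_two]
      rw [this]
    intro x
    rcases le_total 0 x with hx | hx
    · exact hnn x hx
    · have := hnn (-x) (neg_nonneg.2 hx)
      rwa [hodd, neg_mul_neg, neg_sq] at this
  have habs : absPow θ (D * D) = cfc (fun x : ℝ => |x ^ 2| ^ θ) D := by
    rw [absPow, ← pow_two, ← cfc_comp_pow (fun x : ℝ => |x| ^ θ) 2 D
      (continuous_abs_rpow hθ).continuousOn hD]
  have hc : Continuous fun x : ℝ => |x ^ 2| ^ θ := (continuous_abs_rpow hθ).comp (continuous_pow 2)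
  refine ⟨cfc s D, cfc_predicate _ _, ?_, ?_, fun C hC => ?_⟩
  · rw [habs, ← cfc_mul _ _ D hs.continuousOn hs.continuousOn,
      ← cfc_mul _ _ D hc.continuousOn hc.continuousOn]
    simp only [hsq]
  · exact (comp_cfc_eq_cfc_comp hD hD rfl hs).symm
  · have h1 := comp_cfc_eq_cfc_comp hD hD.neg (X := C) hC hs
    have h2 : cfc s (-D) = -cfc s D := by
      rw [← cfc_comp_neg s D hs.continuousOn hD, ← cfc_neg]
      simp only [hodd]
    rwa [h2] at h1

/-- A power `T^(2^(n+1))` with `2^n > θ` has `|T|^θ` as a factor; its exponent is even, so `T` may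
be replaced by `|T|`. Compactness then descends to `T`. -/
lemma isCompactOperator_of_hsNormSq_absPow {θ : ℝ} (hθ : 0 < θ) {T : E →L[ℂ] E}
    (hT : IsSelfAdjoint T) (h : hsNormSq (absPow θ T) < ∞) : IsCompactOperator T := by
  obtain ⟨n, hn⟩ := pow_unbounded_of_one_lt θ (one_lt_two (α := ℝ))
  have hTabs : IsCompactOperator (T ^ 2 ^ (n + 1) : E →L[ℂ] E) := by
    have hc : Continuous fun x : ℝ => |x| ^ (2 ^ (n + 1) - θ : ℝ) :=
      continuous_abs_rpow (by rw [pow_succ]; linarith)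
    have heq : T ^ 2 ^ (n + 1) =
        absPow θ T * cfc (fun x : ℝ => |x| ^ (2 ^ (n + 1) - θ : ℝ)) T := by
      rw [absPow, ← cfc_mul _ _ T (continuous_abs_rpow hθ).continuousOn hc.continuousOn,
        ← cfc_pow_id (R := ℝ) T (2 ^ (n + 1)) hT]
      refine cfc_congr fun x _ => ?_
      change x ^ 2 ^ (n + 1) = |x| ^ θ * |x| ^ (2 ^ (n + 1) - θ : ℝ)
      rw [← Real.rpow_add_of_nonneg (abs_nonneg x) hθ.le (by rw [pow_succ]; linarith),
        add_sub_cancel, ← (Nat.even_pow.2 ⟨even_two, n.succ_ne_zero⟩).pow_abs x,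
        ← Real.rpow_natCast]
      norm_num
    rw [heq]
    exact (isCompactOperator_of_hsNormSq_lt_top h).comp_clm _
  exact isCompactOperator_of_pow_two_pow hT (n + 1) hTabs

end AbsPow

/-! ### Pairs of orthogonal projections and compressions. -/

section Projections

variable {H : Type*} [NormedAddCommGroup H] [InnerProductSpace ℂ H] [CompleteSpace H]

section Algebra

variable {R : Type*} [Ring R] {P Q : R}

/-- Both sides equal `P - P Q P`. -/
lemma sub_sq_mul_left_idempotent (hP : IsIdempotentElem P) (hQ : IsIdempotentElem Q) :
    (P - Q) * (P - Q) * P = P * ((P - Q) * (P - Q)) := by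
  simp only [sub_mul, mul_sub, mul_assoc, hP.eq, hQ.eq]
  simp only [← mul_assoc, hP.eq]; abel

lemma idempotent_mul_sub_sq_mul (hP : IsIdempotentElem P) (hQ : IsIdempotentElem Q) :
    P * ((P - Q) * (P - Q)) * P = P * (1 - Q) * P := by
  simp only [sub_mul, mul_sub, mul_assoc, hP.eq, hQ.eq, mul_one]
  simp only [← mul_assoc, hP.eq]; abel

lemma add_sub_one_mul_sub (hP : IsIdempotentElem P) (hQ : IsIdempotentElem Q) :
    (P + Q - 1) * (P - Q) = -(P - Q) * (P + Q - 1) := by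
  simp only [sub_mul, mul_sub, add_mul, mul_add, neg_mul, one_mul, mul_one, hP.eq, hQ.eq]; abel

end Algebra

-- With `C = P + Q - 1` and `D = P - Q`, one has `2P = 1 + D + C` and `2(1 - Q) = 1 + D - C`; moving
-- `S` across flips the sign of `C` only.
omit [CompleteSpace H] in
lemma mul_eq_one_sub_mul_of_anticommute {P Q S : H →L[ℂ] H} (h1 : S * (P - Q) = (P - Q) * S)
    (h2 : (P + Q - 1) * S = -S * (P + Q - 1)) : S * P = (1 - Q) * S := by
  have h3 : (2 : ℂ) • (S * P) = (2 : ℂ) • ((1 - Q) * S) := by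
    rw [two_smul, two_smul]
    simp only [sub_mul, mul_sub, add_mul, mul_add, neg_mul, one_mul, mul_one] at h1 h2 ⊢
    linear_combination (norm := abel) h1 + h2
  exact smul_right_injective _ two_ne_zero h3

variable (V W : Submodule ℂ H) [CompleteSpace V] [CompleteSpace W]

/-- The difference of the orthogonal projections onto two closed subspaces. -/
noncomputable abbrev projDiff : H →L[ℂ] H := V.starProjection - W.starProjection

lemma isSelfAdjoint_projDiff : IsSelfAdjoint (projDiff V W) :=
  (isSelfAdjoint_starProjection V).sub (isSelfAdjoint_starProjection W)

omit [CompleteSpace H] in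
lemma starProjection_comp_subtypeL : V.starProjection ∘L V.subtypeL = V.subtypeL := by
  ext x
  exact V.starProjection_mem_subspace_eq_self x

omit [CompleteSpace H] in
lemma orthogonalProjectionOnto_comp_starProjection :
    V.orthogonalProjectionOnto ∘L V.starProjection = V.orthogonalProjectionOnto := by
  ext x
  exact V.starProjection_mem_subspace_eq_self (V.orthogonalProjectionOnto x)

omit [CompleteSpace H] in
lemma orthogonalProjectionOnto_comp_subtypeL :
    V.orthogonalProjectionOnto ∘L V.subtypeL = 1 := by
  ext x
  exact V.starProjection_mem_subspace_eq_self x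

/-- The compression of an operator to a closed subspace. -/
noncomputable def compression (T : H →L[ℂ] H) : V →L[ℂ] V :=
  V.orthogonalProjectionOnto ∘L T ∘L V.subtypeL

omit [CompleteSpace H] in
lemma compression_starProjection_conj (T : H →L[ℂ] H) :
    compression V (V.starProjection * T * V.starProjection) = compression V T := by
  calc _ = (V.orthogonalProjectionOnto ∘L V.starProjection) ∘L T ∘L
        (V.starProjection ∘L V.subtypeL) := rfl
    _ = _ := by
      rw [orthogonalProjectionOnto_comp_starProjection, starProjection_comp_subtypeL]; rfl

omit [CompleteSpace H] in
lemma compression_projDiff_sq :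
    compression V (projDiff V W * projDiff V W) = compression V (1 - W.starProjection) := by
  rw [← compression_starProjection_conj, idempotent_mul_sub_sq_mul
    V.isIdempotentElem_starProjection W.isIdempotentElem_starProjection,
    compression_starProjection_conj]

omit [CompleteSpace H] in
lemma compression_one_sub (T : H →L[ℂ] H) : compression V (1 - T) = 1 - compression V T := by
  rw [← orthogonalProjectionOnto_comp_subtypeL V]
  ext x
  simp [compression]

lemma isSelfAdjoint_compression {T : H →L[ℂ] H} (hT : IsSelfAdjoint T) :
    IsSelfAdjoint (compression V T) := by
  rw [ContinuousLinearMap.isSelfAdjoint_iff', compression, ContinuousLinearMap.adjoint_comp,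
    ContinuousLinearMap.adjoint_comp, V.adjoint_subtypeL, V.adjoint_orthogonalProjectionOnto,
    hT.adjoint_eq, ContinuousLinearMap.comp_assoc]

omit [CompleteSpace H] in
lemma subtypeL_comp_compression {T : H →L[ℂ] H}
    (hT : T * V.starProjection = V.starProjection * T) :
    V.subtypeL ∘L compression V T = T ∘L V.subtypeL := by
  calc V.subtypeL ∘L compression V T = (V.starProjection * T) ∘L V.subtypeL := rfl
    _ = T ∘L (V.starProjection ∘L V.subtypeL) := by rw [← hT]; rfl
    _ = _ := by rw [starProjection_comp_subtypeL]

/-- The isometric inclusion of `V` intertwines the compression with `T`, hence also their powers. -/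
lemma hsNormSq_absPow_compression {θ : ℝ} (hθ : 0 < θ) {T : H →L[ℂ] H} (hT : IsSelfAdjoint T)
    (hTV : T * V.starProjection = V.starProjection * T) :
    hsNormSq (absPow θ (compression V T)) < ∞ ↔ hsNormSq (absPow θ T * V.starProjection) < ∞ := by
  have h := comp_cfc_eq_cfc_comp (isSelfAdjoint_compression V hT) hT
    (subtypeL_comp_compression V hTV) (continuous_abs_rpow hθ)
  have h1 : hsNormSq (absPow θ (compression V T)) = hsNormSq (absPow θ T ∘L V.subtypeL) := by
    rw [absPow, absPow, ← h]
    exact hsNormSq_congr fun x => rfl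
  have h2 : absPow θ T * V.starProjection =
      (absPow θ T ∘L V.subtypeL) ∘L V.orthogonalProjectionOnto := rfl
  have h3 : absPow θ T ∘L V.subtypeL = (absPow θ T * V.starProjection) ∘L V.subtypeL := by
    rw [ContinuousLinearMap.mul_def, ContinuousLinearMap.comp_assoc, starProjection_comp_subtypeL]
  rw [h1]
  constructor
  · intro h4
    rw [h2]
    exact hsNormSq_comp_lt_top_right _ h4
  · intro h4
    rw [h3]
    exact hsNormSq_comp_lt_top_right _ h4

end Projections

end RestrictedGrassmannian

namespace RestrictedGrassmannian

/-! ### The restricted Grassmannian. -/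

section Grassmannian

variable {H : Type*} [NormedAddCommGroup H] [InnerProductSpace ℂ H] [CompleteSpace H]

omit [CompleteSpace H] in
lemma projDiff_sq_comm (V W : Submodule ℂ H) [CompleteSpace V] [CompleteSpace W] :
    projDiff V W * projDiff V W = projDiff W V * projDiff W V := by
  rw [← neg_mul_neg, neg_sub]

lemma isSelfAdjoint_projDiff_sq (V W : Submodule ℂ H) [CompleteSpace V] [CompleteSpace W] :
    IsSelfAdjoint (projDiff V W * projDiff V W) := by
  rw [← pow_two]
  exact (isSelfAdjoint_projDiff V W).pow 2

variable (V W : ClosedSubmodule ℂ H)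

lemma adjoint_projOn : (projOn V W).adjoint = projOn W V := by
  rw [projOn, ContinuousLinearMap.adjoint_comp, Submodule.adjoint_subtypeL,
    Submodule.adjoint_orthogonalProjectionOnto, projOn]

lemma projOn_comp_projOn :
    projOn W V ∘L projOn V W = compression V.toSubmodule W.toSubmodule.starProjection := rfl

lemma starProjection_orthogonal_toSubmodule :
    Wᗮ.toSubmodule.starProjection = 1 - W.toSubmodule.starProjection :=
  Submodule.starProjection_orthogonal' W.toSubmodule

lemma projOn_orthogonal_comp_projOn :
    projOn Wᗮ V ∘L projOn V Wᗮ = compression V.toSubmodule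
      (projDiff V.toSubmodule W.toSubmodule * projDiff V.toSubmodule W.toSubmodule) := by
  rw [projOn_comp_projOn, compression_projDiff_sq, starProjection_orthogonal_toSubmodule]

lemma projOn_comp_projOn_eq_one_sub :
    projOn W V ∘L projOn V W = 1 - compression V.toSubmodule
      (projDiff V.toSubmodule W.toSubmodule * projDiff V.toSubmodule W.toSubmodule) := by
  rw [projOn_comp_projOn, compression_projDiff_sq, compression_one_sub, sub_sub_cancel]

lemma isCompactOperator_compression {T : H →L[ℂ] H} (hT : IsCompactOperator T) :
    IsCompactOperator (compression V.toSubmodule T) :=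
  (hT.comp_clm V.toSubmodule.subtypeL).clm_comp V.toSubmodule.orthogonalProjectionOnto

variable {V W}

/-- `C* C` and `C C*` are the identity minus the compressions of `D²` to `V` and to `W`, as `D²` is
symmetric in `V` and `W`. -/
lemma isFredholm_projOn
    (h : IsCompactOperator (projDiff V.toSubmodule W.toSubmodule)) :
    (projOn V W).IsFredholm := by
  have h2 : IsCompactOperator (projDiff V.toSubmodule W.toSubmodule *
      projDiff V.toSubmodule W.toSubmodule : H →L[ℂ] H) := h.comp_clm _
  refine isFredholm_of_isCompactOperator_one_sub (isCompactOperator_compression V h2)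
    (isCompactOperator_compression W h2) ?_ ?_
  · rw [adjoint_projOn, projOn_comp_projOn_eq_one_sub]
  · rw [adjoint_projOn, projOn_comp_projOn_eq_one_sub, projDiff_sq_comm]

/-- If the projection of `V` to `W` is Fredholm, then the projection onto `W` factors through the
projection onto `V`, up to an operator of finite rank. -/
lemma exists_starProjection_eq_of_isFredholm (h : (projOn V W).IsFredholm) :
    ∃ G K : H →L[ℂ] H, K.toLinearMap.HasFiniteRange ∧
      W.toSubmodule.starProjection =
        W.toSubmodule.starProjection * V.toSubmodule.starProjection * G + K := by
  obtain ⟨g, -, hg⟩ := h.exists_isQuasiInverse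
  have hfin : (1 - projOn V W ∘L g).toLinearMap.HasFiniteRange := by
    have h1 := LinearMap.FiniteRangeSetoid.equiv_iff_hasFiniteRange.1 hg.equiv
    have h2 : (1 - projOn V W ∘L g).toLinearMap =
        -((projOn V W).toLinearMap ∘ₗ g.toLinearMap - LinearMap.id) := by
      rw [neg_sub]; rfl
    rw [h2]
    exact h1.neg
  refine ⟨V.toSubmodule.subtypeL ∘L g ∘L W.toSubmodule.orthogonalProjectionOnto,
    W.toSubmodule.subtypeL ∘L (1 - projOn V W ∘L g) ∘L W.toSubmodule.orthogonalProjectionOnto,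
    (hfin.comp_right W.toSubmodule.orthogonalProjectionOnto.toLinearMap).comp_left
      W.toSubmodule.subtype, ?_⟩
  ext x
  have hx : V.toSubmodule.starProjection (g (W.toSubmodule.orthogonalProjectionOnto x)) =
    g (W.toSubmodule.orthogonalProjectionOnto x) :=
    V.toSubmodule.starProjection_mem_subspace_eq_self _
  change W.toSubmodule.starProjection x = W.toSubmodule.starProjection
      (V.toSubmodule.starProjection (g (W.toSubmodule.orthogonalProjectionOnto x))) +
    (W.toSubmodule.starProjection x - W.toSubmodule.starProjection
      (g (W.toSubmodule.orthogonalProjectionOnto x)))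
  rw [hx, add_sub_cancel]

lemma isSchatten_projOn_orthogonal_iff {p : ℝ≥0∞} (hp0 : p ≠ 0) (hp : p ≠ ∞) :
    IsSchatten p (projOn V Wᗮ) ↔ hsNormSq (absPow (p.toReal / 4)
      (projDiff V.toSubmodule W.toSubmodule * projDiff V.toSubmodule W.toSubmodule) *
        V.toSubmodule.starProjection) < ∞ := by
  rw [isSchatten_iff_hsNormSq_lt_top hp0 hp, adjoint_projOn, projOn_orthogonal_comp_projOn,
    hsNormSq_absPow_compression _ (div_pos (ENNReal.toReal_pos hp0 hp) four_pos)
      (isSelfAdjoint_projDiff_sq _ _)]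
  exact sub_sq_mul_left_idempotent V.toSubmodule.isIdempotentElem_starProjection
    W.toSubmodule.isIdempotentElem_starProjection

lemma isSchatten_projDiff_iff {p : ℝ≥0∞} (hp0 : p ≠ 0) (hp : p ≠ ∞) :
    IsSchatten p (projDiff V.toSubmodule W.toSubmodule) ↔ hsNormSq (absPow (p.toReal / 4)
      (projDiff V.toSubmodule W.toSubmodule * projDiff V.toSubmodule W.toSubmodule)) < ∞ := by
  rw [isSchatten_iff_hsNormSq_lt_top hp0 hp, (isSelfAdjoint_projDiff _ _).adjoint_eq]
  rfl

/-- The odd power `S` of `D` has `S² = R²`, so it can replace `R` on the left in Hilbert-Schmidt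
norms; then `S P = (1 - Q) S` is the adjoint of `S (1 - Q)`. -/
lemma hsNormSq_mul_starProjection_orthogonal {θ : ℝ} (hθ : 0 < θ) (V W : Submodule ℂ H)
    [CompleteSpace V] [CompleteSpace W] :
    hsNormSq (absPow θ (projDiff V W * projDiff V W) * (1 - W.starProjection)) =
      hsNormSq (absPow θ (projDiff V W * projDiff V W) * V.starProjection) := by
  obtain ⟨S, hS, hSR, hSD, hSC⟩ :=
    exists_mul_self_eq_absPow_mul_self hθ (isSelfAdjoint_projDiff V W)
  have hSP : S * V.starProjection = (1 - W.starProjection) * S :=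
    mul_eq_one_sub_mul_of_anticommute hSD (hSC _ (add_sub_one_mul_sub
      V.isIdempotentElem_starProjection W.isIdempotentElem_starProjection))
  have hnorm := norm_apply_eq_of_mul_self_eq hS (isSelfAdjoint_absPow θ _) hSR
  have hR : ∀ X : H →L[ℂ] H,
      hsNormSq (absPow θ (projDiff V W * projDiff V W) * X) = hsNormSq (S * X) :=
    fun X => hsNormSq_congr fun x => (hnorm (X x)).symm
  have hQ : IsSelfAdjoint (1 - W.starProjection) :=
    (IsSelfAdjoint.one _).sub (isSelfAdjoint_starProjection W)
  rw [hR, hR, hSP, ← hsNormSq_adjoint, ContinuousLinearMap.mul_def,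
    ContinuousLinearMap.adjoint_comp, hS.adjoint_eq, hQ.adjoint_eq, ContinuousLinearMap.mul_def]

lemma isSchatten_projDiff_of_ne_top {p : ℝ≥0∞} (hp0 : p ≠ 0) (hp : p ≠ ∞)
    (hF : (projOn V W).IsFredholm) (hS : IsSchatten p (projOn V Wᗮ)) :
    IsSchatten p (projDiff V.toSubmodule W.toSubmodule) := by
  have hθ : 0 < p.toReal / 4 := div_pos (ENNReal.toReal_pos hp0 hp) four_pos
  rw [isSchatten_projOn_orthogonal_iff hp0 hp] at hS
  rw [isSchatten_projDiff_iff hp0 hp]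
  set P := V.toSubmodule.starProjection with hP
  set Q := W.toSubmodule.starProjection with hQ
  have h1 := hsNormSq_mul_starProjection_orthogonal hθ V.toSubmodule W.toSubmodule
  rw [← hP, ← hQ] at h1
  set R := absPow (p.toReal / 4) ((P - Q) * (P - Q)) with hR
  have hRQ : R * Q = Q * R := by
    refine (comp_cfc_eq_cfc_comp (isSelfAdjoint_projDiff_sq V.toSubmodule W.toSubmodule)
      (isSelfAdjoint_projDiff_sq V.toSubmodule W.toSubmodule) (X := Q) ?_
      (continuous_abs_rpow hθ)).symm
    have := sub_sq_mul_left_idempotent W.toSubmodule.isIdempotentElem_starProjection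
      V.toSubmodule.isIdempotentElem_starProjection
    rw [projDiff_sq_comm]
    exact this.symm
  obtain ⟨G, K, hK, hGK⟩ := exists_starProjection_eq_of_isFredholm hF
  have h2 : hsNormSq (R * Q) < ∞ := by
    -- Commuting `R` past `Q` exposes the Hilbert-Schmidt factor `R P`.
    have h3 : R * Q = (Q ∘L (R * P)) ∘L G + R ∘L K := by
      calc R * Q = R * (Q * P * G + K) := congrArg (R * ·) hGK
        _ = R * Q * P * G + R * K := by simp only [mul_add, mul_assoc]
        _ = _ := by rw [hRQ]; rfl
    rw [h3]
    exact hsNormSq_add_lt_top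
      (hsNormSq_comp_lt_top_right _ (hsNormSq_comp_lt_top_left _ hS))
      (hsNormSq_comp_lt_top_left _ (hsNormSq_lt_top_of_hasFiniteRange hK))
  have h4 : R = R * Q + R * (1 - Q) := by rw [← mul_add, add_sub_cancel, mul_one]
  rw [h4]
  exact hsNormSq_add_lt_top h2 (by rwa [h1])

lemma isCompactOperator_projDiff (hF : (projOn V W).IsFredholm)
    (hS : IsCompactOperator (projOn V Wᗮ)) :
    IsCompactOperator (projDiff V.toSubmodule W.toSubmodule) := by
  set P := V.toSubmodule.starProjection with hP
  set Q := W.toSubmodule.starProjection with hQ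
  have hPi : IsIdempotentElem P := V.toSubmodule.isIdempotentElem_starProjection
  have hQi : IsIdempotentElem Q := W.toSubmodule.isIdempotentElem_starProjection
  have hQP : IsCompactOperator ((1 - Q) * P : H →L[ℂ] H) := by
    have h1 : (1 - Q) * P = Wᗮ.toSubmodule.subtypeL ∘L projOn V Wᗮ ∘L
        V.toSubmodule.orthogonalProjectionOnto := by
      rw [hQ, ← starProjection_orthogonal_toSubmodule]; rfl
    rw [h1]
    exact (hS.comp_clm _).clm_comp Wᗮ.toSubmodule.subtypeL
  obtain ⟨G, K, hK, hGK⟩ := exists_starProjection_eq_of_isFredholm hF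
  have hDQ : IsCompactOperator ((P - Q) * Q : H →L[ℂ] H) := by
    have h1 : (P - Q) * Q = (1 - P) * ((1 - Q) * P) * G - (1 - P) * K := by
      have h2 : (1 - P) * Q = (1 - P) * (Q * P * G + K) := congrArg ((1 - P) * ·) hGK
      have h3 : (P - Q) * Q = -((1 - P) * Q) := by
        simp only [sub_mul, one_mul, hQi.eq, neg_sub]
      have h4 : (1 - P) * ((1 - Q) * P) = -((1 - P) * Q * P) := by
        simp only [sub_mul, mul_sub, one_mul, mul_assoc, hPi.eq]; abel
      rw [h3, h2, h4]
      simp only [mul_add, neg_mul, mul_assoc]; abel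
    rw [h1]
    have h5 : IsCompactOperator ((1 - P) * ((1 - Q) * P) * G : H →L[ℂ] H) :=
      (hQP.clm_comp (1 - P : H →L[ℂ] H)).comp_clm G
    have h6 : IsCompactOperator ((1 - P) * K : H →L[ℂ] H) :=
      (isCompactOperator_of_hasFiniteRange hK).clm_comp (1 - P : H →L[ℂ] H)
    exact h5.sub h6
  -- Write `D² = D² Q + (1 - Q) D²`, using that `D²` commutes with `Q`, and `(1 - Q) D = (1 - Q) P`.
  have hsq : (P - Q) * (P - Q) = (P - Q) * ((P - Q) * Q) + (1 - Q) * P * (P - Q) := by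
    have h1 : (1 - Q) * P = (1 - Q) * (P - Q) := by
      simp only [sub_mul, mul_sub, one_mul, hQi.eq]; abel
    have h2 := sub_sq_mul_left_idempotent hQi hPi
    rw [show (Q - P) * (Q - P) = (P - Q) * (P - Q) by rw [← neg_mul_neg, neg_sub]] at h2
    rw [h1, ← mul_assoc, h2, mul_assoc (1 - Q), sub_mul 1 Q, one_mul, add_sub_cancel]
  have h2 : IsCompactOperator ((P - Q) ^ 2 ^ 1 : H →L[ℂ] H) := by
    rw [pow_one, pow_two, hsq]
    exact (hDQ.clm_comp (P - Q)).add (hQP.comp_clm (P - Q))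
  exact isCompactOperator_of_pow_two_pow (isSelfAdjoint_projDiff _ _) 1 h2

lemma mem_grRes_of_isSchatten {p : ℝ≥0∞} (hp0 : p ≠ 0)
    (h : IsSchatten p (projDiff V.toSubmodule W.toSubmodule)) : V ∈ grRes p W := by
  by_cases hp : p = ∞
  · rw [IsSchatten, if_pos hp] at h
    refine ⟨isFredholm_projOn h, ?_⟩
    rw [IsSchatten, if_pos hp]
    refine isCompactOperator_of_adjoint_comp_self ?_
    rw [adjoint_projOn, projOn_orthogonal_comp_projOn]
    exact isCompactOperator_compression V (h.comp_clm _)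
  · have hθ : 0 < p.toReal / 4 := div_pos (ENNReal.toReal_pos hp0 hp) four_pos
    rw [isSchatten_projDiff_iff hp0 hp] at h
    -- For finite `p` this gives compactness of `D² = D* D`, hence of `D`.
    have hsq := isCompactOperator_of_hsNormSq_absPow hθ (isSelfAdjoint_projDiff_sq _ _) h
    refine ⟨isFredholm_projOn (isCompactOperator_of_adjoint_comp_self ?_), ?_⟩
    · rwa [(isSelfAdjoint_projDiff _ _).adjoint_eq]
    · rw [isSchatten_projOn_orthogonal_iff hp0 hp]
      exact hsNormSq_comp_lt_top_right _ h

end Grassmannian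

end RestrictedGrassmannian

theorem mainTheorem6 {H : Type*} [NormedAddCommGroup H] [InnerProductSpace ℂ H] [CompleteSpace H]
    [TopologicalSpace.SeparableSpace H] (Hplus : ClosedSubmodule ℂ H)
    (hplus : ¬ FiniteDimensional ℂ Hplus.toSubmodule) (hminus : ¬ FiniteDimensional ℂ Hplusᗮ.toSubmodule)
    (p : ENNReal) (hp : 1 ≤ p) (V : ClosedSubmodule ℂ H) :
    V ∈ RestrictedGrassmannian.grRes p Hplus ↔
      RestrictedGrassmannian.IsSchatten p
        (V.toSubmodule.starProjection - Hplus.toSubmodule.starProjection) := by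
  have hp0 : p ≠ 0 := (zero_lt_one.trans_le hp).ne'
  refine ⟨fun ⟨hF, hS⟩ => ?_, RestrictedGrassmannian.mem_grRes_of_isSchatten hp0⟩
  by_cases hpt : p = ⊤
  · rw [RestrictedGrassmannian.IsSchatten, if_pos hpt] at hS ⊢
    exact RestrictedGrassmannian.isCompactOperator_projDiff hF hS
  · exact RestrictedGrassmannian.isSchatten_projDiff_of_ne_top hp0 hpt hF hS
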